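/- Let $K$ be a field of characteristic $0$, let $q\in K$ with $q\neq 0$, and let $n\ge 2$. Let $K\langle D\rangle$ be the free associative unital $K$-algebra on the letters $D_{ij}$, $1\le i,j\le n$, and let $S\subset K\langle D\rangle$ be the set of defining relations of the Dipper–Donkin quantized matrix algebra $D_q(n)=K\langle D\rangle/\langle S\rangle$, that is, the set of all elements $$\begin{array}{ll} f_{ijst}=D_{ij}D_{st}-qD_{st}D_{ij}, & i>s,\ j\le t,\\ g_{ijst}=D_{ij}D_{st}-D_{st}D_{ij}-(q-1)D_{sj}D_{it}, & i>s,\ j>t,\\ h_{ijik}=D_{ij}D_{ik}-D_{ik}D_{ij}, & \text{all } i,j,k.\end{array}$$ Order the letters by $D_{kl}<D_{ij}$ iff $k<i$, or $k=i$ and $l<j$. Let $\prec$ be the deg-lex ordering on words: $u\prec v$ iff $u$ is shorter than $v$, or $u$ and $v$ have the same length and, at the first position where they differ, the letter of $u$ is smaller than that of $v$. For a nonzero $p\in K\langle D\rangle$ let $\overline p$ denote the $\prec$-largest word occurring in $p$, and let $\mathrm{lc}(p)$ be its coefficient. Then $\prec$ is a monomial ordering (a well-ordering such that $u\prec v$ implies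 $wuz\prec wvz$ for all words $u,v,w,z$), and $S$ is a Gröbner–Shirshov basis, with respect to $\prec$, of the two-sided ideal $J=\langle S\rangle$ of $K\langle D\rangle$. Explicitly: 1. for every nonzero $p\in J$ there is a nonzero $s\in S$ such that $\overline s$ is a subword (a block of consecutive letters) of $\overline p$; 2. all compositions of elements of $S$ are trivial. That is, let $p,p'\in S$ be nonzero and let $w,a,b$ be words. If $w=\overline p\,b=a\,\overline{p'}$ and $|w|<|\overline p|+|\overline{p'}|$, then $\mathrm{lc}(p)^{-1}pb-\mathrm{lc}(p')^{-1}ap'$ is trivial modulo $(S,w)$. If $w=\overline p=a\,\overline{p'}\,b$, then $\mathrm{lc}(p)^{-1}p-\mathrm{lc}(p')^{-1}ap'b$ is trivial modulo $(S,w)$. Here an element is trivial modulo $(S,w)$ if it is a $K$-linear combination of elements $csd$ with $s\in S$ nonzero, $c,d$ words, and $c\,\overline s\,d\prec w$. -/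

import Mathlib

namespace DipperDonkin

/-- The element of the free algebra given by a word in the generators. -/
noncomputable def wordElt (K : Type*) [Field K] {X : Type*} (u : FreeMonoid X) : FreeAlgebra K X :=
  FreeMonoid.lift (FreeAlgebra.ι K) u

/-- The coefficient of the word `u` in the noncommutative polynomial `f`. -/
noncomputable def coeff {K : Type*} [Field K] {X : Type*} (f : FreeAlgebra K X)
    (u : FreeMonoid X) : K :=
  (FreeAlgebra.basisFreeMonoid K X).repr f u

/-- A (strict) monomial ordering on words: a well-ordering that is compatible with
multiplication on both sides. -/
structure IsMonomialOrder {X : Type*} (r : FreeMonoid X → FreeMonoid X → Prop) : Prop where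
  wellOrder : IsWellOrder (FreeMonoid X) r
  mul_mul : ∀ u v w z : FreeMonoid X, r u v → r (w * u * z) (w * v * z)

/-- `u` is the leading word of `f` with respect to the strict order `r`: it occurs in `f`, and
every other word that occurs in `f` is smaller. The zero polynomial has no leading word. -/
def IsLeadingWord {K : Type*} [Field K] {X : Type*} (r : FreeMonoid X → FreeMonoid X → Prop)
    (f : FreeAlgebra K X) (u : FreeMonoid X) : Prop :=
  coeff f u ≠ 0 ∧ ∀ v : FreeMonoid X, coeff f v ≠ 0 → v ≠ u → r v u

/-- `p` is trivial modulo `(S, w)`: it is a linear combination of elements `a s b` with `s ∈ S`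
nonzero, `a`, `b` words, and `a * (leading word of s) * b` strictly smaller than `w`. -/
def IsTrivialMod {K : Type*} [Field K] {X : Type*} (r : FreeMonoid X → FreeMonoid X → Prop)
    (S : Set (FreeAlgebra K X)) (w : FreeMonoid X) (p : FreeAlgebra K X) : Prop :=
  p ∈ Submodule.span K {x : FreeAlgebra K X |
    ∃ s ∈ S, ∃ u a b : FreeMonoid X, IsLeadingWord r s u ∧ r (a * u * b) w ∧
      x = wordElt K a * s * wordElt K b}

/-- All compositions (of intersection and of inclusion) of elements of `S` are trivial. Elements
of `S` are made monic by dividing by their leading coefficients; a zero element of `S`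
has no compositions. -/
def CompositionsTrivial {K : Type*} [Field K] {X : Type*}
    (r : FreeMonoid X → FreeMonoid X → Prop) (S : Set (FreeAlgebra K X)) : Prop :=
  ∀ f ∈ S, ∀ g ∈ S, ∀ u v : FreeMonoid X, IsLeadingWord r f u → IsLeadingWord r g v →
    (∀ w a b : FreeMonoid X, w = u * b → w = a * v → w.length < u.length + v.length →
      IsTrivialMod r S w
        ((coeff f u)⁻¹ • (f * wordElt K b) - (coeff g v)⁻¹ • (wordElt K a * g))) ∧
    (∀ w a b : FreeMonoid X, w = u → w = a * v * b →
      IsTrivialMod r S w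
        ((coeff f u)⁻¹ • f - (coeff g v)⁻¹ • (wordElt K a * g * wordElt K b)))

/-- `S` is a Gröbner–Shirshov basis of the two-sided ideal `J`: it generates `J`, and every
nonzero element of `J` has a leading word that contains the leading word of some element of `S`
as a subword. -/
structure IsGroebnerShirshovBasis {K : Type*} [Field K] {X : Type*}
    (r : FreeMonoid X → FreeMonoid X → Prop) (S : Set (FreeAlgebra K X))
    (J : TwoSidedIdeal (FreeAlgebra K X)) : Prop where
  span_eq : TwoSidedIdeal.span S = J
  leading : ∀ f ∈ J, f ≠ 0 → ∃ w : FreeMonoid X, IsLeadingWord r f w ∧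
    ∃ s ∈ S, ∃ u a b : FreeMonoid X, IsLeadingWord r s u ∧ w = a * u * b

/-- The order on letters: `D k l < D i j` iff `k < i`, or `k = i` and `l < j`. -/
def letterLT {n : ℕ} (x y : Fin n × Fin n) : Prop :=
  x.1 < y.1 ∨ (x.1 = y.1 ∧ x.2 < y.2)

/-- The deg-lex ordering on words: first by length, then lexicographically from the left. -/
def degLex {n : ℕ} (u v : FreeMonoid (Fin n × Fin n)) : Prop :=
  List.Shortlex letterLT u.toList v.toList

section Relations

variable (K : Type*) [Field K] {n : ℕ}

/-- The free generator `D i j`. -/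
noncomputable def D (i j : Fin n) : FreeAlgebra K (Fin n × Fin n) :=
  FreeAlgebra.ι K (i, j)

noncomputable def f (q : K) (i j s t : Fin n) : FreeAlgebra K (Fin n × Fin n) :=
  D K i j * D K s t - q • (D K s t * D K i j)

noncomputable def g (q : K) (i j s t : Fin n) : FreeAlgebra K (Fin n × Fin n) :=
  D K i j * D K s t - D K s t * D K i j - (q - 1) • (D K s j * D K i t)

noncomputable def h (i j k : Fin n) : FreeAlgebra K (Fin n × Fin n) :=
  D K i j * D K i k - D K i k * D K i j

/-- The set of defining relations of the Dipper–Donkin quantized matrix algebra. -/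
def relations (n : ℕ) (q : K) : Set (FreeAlgebra K (Fin n × Fin n)) :=
  {x | ∃ i j s t : Fin n, s < i ∧ j ≤ t ∧ x = f K q i j s t} ∪
  {x | ∃ i j s t : Fin n, s < i ∧ t < j ∧ x = g K q i j s t} ∪
  {x | ∃ i j k : Fin n, x = h K i j k}

end Relations

end DipperDonkin

/-!
Deg-lex is a monomial ordering because letters are well-ordered and only words of equal length are
compared lexicographically.

The nonzero defining relations are, up to sign, the elements
`monicRel q x y = x y - (swapCoeff q x y) y x - (crossCoeff q x y) y' x'` for letters `y < x`, where
`y' x'` has the rows of `y x` and the columns of `x y`. Their leading words are the decreasing words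
`x y`, so each relation rewrites a descent, and the only compositions that are not zero are the
overlaps `x y z` with `z < y < x`. Such an overlap is trivial because both ways of rewriting
`x y z` give the same result, using only rules applied to words smaller than `x y z`
(`rewriting_confluent`). On words with distinct rows, the rules sort the rows while acting on
the columns by an operator of Hecke type with parameter `q`, and the equality is the
braid relation; if two rows coincide, one needs in addition that letters of one row commute.

The statement about the ideal then follows from the composition-diamond lemma
(`CompositionsTrivial.isGroebnerShirshovBasis`), which is proved for any monomial ordering. Trivial
compositions make two normalized multiples `a s b`, `a' s' b'` with the same leading word agree
modulo multiples with smaller leading words (`sub_mem_multipleSpan`). Hence an element of the ideal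
is `c • a s b` plus multiples with smaller leading words. If `c ≠ 0`, its leading word is that of
`a s b`; if `c = 0`, well-founded induction applies.
-/

namespace DipperDonkin

/-! ### Words and coefficients -/

section Coefficients

variable {K : Type*} [Field K] {X : Type*}

lemma wordElt_mul (u v : FreeMonoid X) : wordElt K (u * v) = wordElt K u * wordElt K v :=
  map_mul _ _ _

lemma wordElt_one : wordElt K (1 : FreeMonoid X) = 1 := map_one _

lemma wordElt_of (x : X) : wordElt K (FreeMonoid.of x) = FreeAlgebra.ι K x :=
  FreeMonoid.lift_eval_of _ _

lemma basisFreeMonoid_apply (u : FreeMonoid X) :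
    FreeAlgebra.basisFreeMonoid K X u = wordElt K u := by
  simp [FreeAlgebra.basisFreeMonoid, wordElt, FreeAlgebra.equivMonoidAlgebraFreeMonoid,
    MonoidAlgebra.lift_apply]

lemma coeff_add (p p' : FreeAlgebra K X) (u : FreeMonoid X) :
    coeff (p + p') u = coeff p u + coeff p' u := by
  simp [coeff]

lemma coeff_smul (c : K) (p : FreeAlgebra K X) (u : FreeMonoid X) :
    coeff (c • p) u = c * coeff p u := by
  simp [coeff]

lemma coeff_wordElt_self (u : FreeMonoid X) : coeff (wordElt K u) u = 1 := by
  simp [coeff, ← basisFreeMonoid_apply]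

lemma coeff_wordElt_ne {u v : FreeMonoid X} (huv : u ≠ v) : coeff (wordElt K u) v = 0 := by
  simp [coeff, ← basisFreeMonoid_apply, huv]

lemma span_range_wordElt :
    Submodule.span K (Set.range (wordElt K (X := X))) = ⊤ := by
  have h := (FreeAlgebra.basisFreeMonoid K X).span_eq
  rwa [funext basisFreeMonoid_apply] at h

end Coefficients

/-! ### Leading words -/

section LeadingWords

variable {K : Type*} [Field K] {X : Type*} {r : FreeMonoid X → FreeMonoid X → Prop}

variable (K r) in
/-- The space of polynomials all of whose words are smaller than `w`. -/
noncomputable def lowerSpan (w : FreeMonoid X) : Submodule K (FreeAlgebra K X) :=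
  Submodule.span K (wordElt K '' {v | r v w})

lemma mem_lowerSpan_iff {w : FreeMonoid X} {p : FreeAlgebra K X} :
    p ∈ lowerSpan K r w ↔ ∀ v, coeff p v ≠ 0 → r v w := by
  rw [lowerSpan, ← funext (basisFreeMonoid_apply (K := K)), Module.Basis.mem_span_image]
  simp [Set.subset_def, coeff]

lemma wordElt_mem_lowerSpan {v w : FreeMonoid X} (hvw : r v w) : wordElt K v ∈ lowerSpan K r w :=
  Submodule.subset_span ⟨v, hvw, rfl⟩

lemma IsMonomialOrder.irrefl (hr : IsMonomialOrder r) (u : FreeMonoid X) : ¬ r u u :=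
  have := hr.wellOrder
  irrefl_of r u

lemma IsMonomialOrder.trans (hr : IsMonomialOrder r) {u v w : FreeMonoid X} (huv : r u v)
    (hvw : r v w) : r u w :=
  have := hr.wellOrder
  trans_of r huv hvw

lemma lowerSpan_mono (hr : IsMonomialOrder r) {v w : FreeMonoid X} (hvw : r v w) :
    lowerSpan K r v ≤ lowerSpan K r w :=
  Submodule.span_mono (Set.image_mono fun _ hu => hr.trans hu hvw)

lemma coeff_eq_of_mem_lowerSpan (hr : IsMonomialOrder r) {u : FreeMonoid X}
    {t : FreeAlgebra K X} (ht : t ∈ lowerSpan K r u) (c : K) :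
    coeff (c • wordElt K u + t) u = c := by
  have h0 : coeff t u = 0 := by
    by_contra h
    exact hr.irrefl u (mem_lowerSpan_iff.1 ht u h)
  simp [coeff_add, coeff_smul, coeff_wordElt_self, h0]

lemma isLeadingWord_of_mem_lowerSpan (hr : IsMonomialOrder r) {u : FreeMonoid X}
    {t : FreeAlgebra K X} (ht : t ∈ lowerSpan K r u) {c : K} (hc : c ≠ 0) :
    IsLeadingWord r (c • wordElt K u + t) u := by
  refine ⟨by rwa [coeff_eq_of_mem_lowerSpan hr ht], fun v hv hvu => ?_⟩
  refine mem_lowerSpan_iff.1 ht v ?_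
  simpa [coeff_add, coeff_smul, coeff_wordElt_ne hvu.symm] using hv

lemma IsLeadingWord.exists_eq {p : FreeAlgebra K X} {u : FreeMonoid X}
    (hp : IsLeadingWord r p u) :
    ∃ t ∈ lowerSpan K r u, p = coeff p u • wordElt K u + t := by
  refine ⟨p - coeff p u • wordElt K u, mem_lowerSpan_iff.2 fun v hv => ?_, by abel⟩
  rw [sub_eq_add_neg, ← neg_smul, coeff_add, coeff_smul] at hv
  by_cases hvu : u = v
  · subst hvu
    simp [coeff_wordElt_self] at hv
  · exact hp.2 v (by simpa [coeff_wordElt_ne hvu] using hv) (Ne.symm hvu)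

lemma IsLeadingWord.unique (hr : IsMonomialOrder r) {p : FreeAlgebra K X} {u v : FreeMonoid X}
    (hu : IsLeadingWord r p u) (hv : IsLeadingWord r p v) : u = v := by
  by_contra h
  exact hr.irrefl u (hr.trans (hv.2 u hu.1 h) (hu.2 v hv.1 (Ne.symm h)))

lemma exists_isLeadingWord (hr : IsMonomialOrder r) {p : FreeAlgebra K X} (hp : p ≠ 0) :
    ∃ u, IsLeadingWord r p u := by
  classical
  have := hr.wellOrder
  let _ := linearOrderOfSTO r
  have hne : ((FreeAlgebra.basisFreeMonoid K X).repr p).support.Nonempty := by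
    simpa using hp
  obtain ⟨u, hu, hmax⟩ := Finset.exists_max_image _ id hne
  refine ⟨u, Finsupp.mem_support_iff.1 hu, fun v hv hvu => ?_⟩
  exact lt_of_le_of_ne (hmax v (Finsupp.mem_support_iff.2 hv)) hvu

lemma mul_mul_mem_lowerSpan (hr : IsMonomialOrder r) {w : FreeMonoid X} {p : FreeAlgebra K X}
    (hp : p ∈ lowerSpan K r w) (a b : FreeMonoid X) :
    wordElt K a * p * wordElt K b ∈ lowerSpan K r (a * w * b) := by
  induction hp using Submodule.span_induction with
  | mem x hx =>
    obtain ⟨v, hv, rfl⟩ := hx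
    rw [← wordElt_mul, ← wordElt_mul]
    exact wordElt_mem_lowerSpan (hr.mul_mul _ _ _ _ hv)
  | zero => simp
  | add x y _ _ hx hy => simpa [mul_add, add_mul] using add_mem hx hy
  | smul c x _ hx => simpa using Submodule.smul_mem _ c hx

lemma IsLeadingWord.mul_mul (hr : IsMonomialOrder r) {p : FreeAlgebra K X} {u : FreeMonoid X}
    (hp : IsLeadingWord r p u) (a b : FreeMonoid X) :
    ∃ t ∈ lowerSpan K r (a * u * b),
      wordElt K a * p * wordElt K b = coeff p u • wordElt K (a * u * b) + t := by
  obtain ⟨t, ht, he⟩ := hp.exists_eq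
  refine ⟨_, mul_mul_mem_lowerSpan hr ht a b, ?_⟩
  conv_lhs => rw [he]
  simp [mul_add, add_mul, wordElt_mul]

end LeadingWords

/-! ### The composition-diamond lemma -/

section Diamond

variable {K : Type*} [Field K] {X : Type*} {r : FreeMonoid X → FreeMonoid X → Prop}
  {S : Set (FreeAlgebra K X)}

variable (r S) in
/-- The span of the multiples `a s b` of elements `s` of `S` by words whose leading word
satisfies `Q`. For `Q = (r · w)` this is the space of elements that are trivial
modulo `(S, w)`. -/
noncomputable def multipleSpan (Q : FreeMonoid X → Prop) : Submodule K (FreeAlgebra K X) :=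
  Submodule.span K {x : FreeAlgebra K X |
    ∃ s ∈ S, ∃ u a b : FreeMonoid X, IsLeadingWord r s u ∧ Q (a * u * b) ∧
      x = wordElt K a * s * wordElt K b}

lemma isTrivialMod_iff {w : FreeMonoid X} {p : FreeAlgebra K X} :
    IsTrivialMod r S w p ↔ p ∈ multipleSpan r S (r · w) := Iff.rfl

lemma mul_mul_mem_multipleSpan {Q Q' : FreeMonoid X → Prop} (a b : FreeMonoid X)
    (hQ : ∀ v, Q v → Q' (a * v * b)) {p : FreeAlgebra K X} (hp : p ∈ multipleSpan r S Q) :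
    wordElt K a * p * wordElt K b ∈ multipleSpan r S Q' := by
  induction hp using Submodule.span_induction with
  | mem x hx =>
    obtain ⟨s, hs, u, a', b', hu, hlt, rfl⟩ := hx
    refine Submodule.subset_span ⟨s, hs, u, a * a', b' * b, hu, ?_, ?_⟩
    · simpa [mul_assoc] using hQ _ hlt
    · simp [wordElt_mul, mul_assoc]
  | zero => simp
  | add x y _ _ hx hy => simpa [mul_add, add_mul] using add_mem hx hy
  | smul c x _ hx => simpa using Submodule.smul_mem _ c hx

lemma multipleSpan_mono {Q Q' : FreeMonoid X → Prop} (hQ : ∀ v, Q v → Q' v) :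
    multipleSpan r S Q ≤ multipleSpan r S Q' :=
  Submodule.span_mono fun _ ⟨s, hs, u, a, b, hu, hlt, hx⟩ => ⟨s, hs, u, a, b, hu, hQ _ hlt, hx⟩

lemma multipleSpan_le_lowerSpan (hr : IsMonomialOrder r) (w : FreeMonoid X) :
    multipleSpan r S (r · w) ≤ lowerSpan K r w := by
  refine Submodule.span_le.2 ?_
  rintro _ ⟨s, -, u, a, b, hu, hlt, rfl⟩
  obtain ⟨t, ht, he⟩ := hu.mul_mul hr a b
  rw [he]
  exact add_mem (Submodule.smul_mem _ _ (wordElt_mem_lowerSpan hlt)) (lowerSpan_mono hr hlt ht)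

/-- Two factorizations of a word have a common refinement. -/
lemma mul_eq_mul_cases {a b c d : FreeMonoid X} (habcd : a * b = c * d) :
    (∃ e, c = a * e ∧ b = e * d) ∨ (∃ e, a = c * e ∧ d = e * b) :=
  List.append_eq_append_iff.1 habcd

lemma mul_lowerSpan_mem_multipleSpan (hr : IsMonomialOrder r) {s t : FreeAlgebra K X}
    (hs : s ∈ S) {u v : FreeMonoid X} (hu : IsLeadingWord r s u) (e : FreeMonoid X)
    (ht : t ∈ lowerSpan K r v) :
    s * wordElt K e * t ∈ multipleSpan r S (r · (u * e * v)) := by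
  induction ht using Submodule.span_induction with
  | mem x hx =>
    obtain ⟨z, hz, rfl⟩ := hx
    refine Submodule.subset_span ⟨s, hs, u, 1, e * z, hu, ?_, ?_⟩
    · simpa [mul_assoc] using hr.mul_mul _ _ (u * e) 1 hz
    · simp [wordElt_mul, wordElt_one, mul_assoc]
  | zero => simp
  | add x y _ _ hx hy => simpa [mul_add] using add_mem hx hy
  | smul c x _ hx => simpa using Submodule.smul_mem _ c hx

lemma lowerSpan_mul_mem_multipleSpan (hr : IsMonomialOrder r) {s t : FreeAlgebra K X}
    (hs : s ∈ S) {u v : FreeMonoid X} (hu : IsLeadingWord r s u) (e : FreeMonoid X)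
    (ht : t ∈ lowerSpan K r v) :
    t * wordElt K e * s ∈ multipleSpan r S (r · (v * e * u)) := by
  induction ht using Submodule.span_induction with
  | mem x hx =>
    obtain ⟨z, hz, rfl⟩ := hx
    refine Submodule.subset_span ⟨s, hs, u, z * e, 1, hu, ?_, ?_⟩
    · simpa [mul_assoc] using hr.mul_mul _ _ 1 (e * u) hz
    · simp [wordElt_mul, wordElt_one]
  | zero => simp
  | add x y _ _ hx hy => simpa [add_mul] using add_mem hx hy
  | smul c x _ hx => simpa using Submodule.smul_mem _ c hx

/-- Two multiples whose leading words come from disjoint occurrences agree modulo smaller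
multiples: for monic `s = u + t` and `s' = u' + t'`, the difference `s e u' - u e s'` equals
`t e s' - s e t'`. -/
lemma disjoint_sub_mem_multipleSpan (hr : IsMonomialOrder r) {s s' : FreeAlgebra K X}
    (hs : s ∈ S) (hs' : s' ∈ S) {u u' : FreeMonoid X} (hu : IsLeadingWord r s u)
    (hu' : IsLeadingWord r s' u') (e : FreeMonoid X) :
    (coeff s u)⁻¹ • (s * wordElt K (e * u')) - (coeff s' u')⁻¹ • (wordElt K (u * e) * s') ∈
      multipleSpan r S (r · (u * e * u')) := by
  obtain ⟨t, ht, he⟩ := hu.exists_eq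
  obtain ⟨t', ht', he'⟩ := hu'.exists_eq
  have h1 := mul_lowerSpan_mem_multipleSpan hr hs hu e ht'
  have h2 := lowerSpan_mul_mem_multipleSpan hr hs' hu' e ht
  have hc := hu.1
  have hc' := hu'.1
  set c := coeff s u
  set c' := coeff s' u'
  have e1 : wordElt K u = c⁻¹ • (s - t) := by
    conv_rhs => rw [he]
    simp [smul_smul, hc]
  have e2 : wordElt K u' = c'⁻¹ • (s' - t') := by
    conv_rhs => rw [he']
    simp [smul_smul, hc']
  have key : c⁻¹ • (s * wordElt K (e * u')) - c'⁻¹ • (wordElt K (u * e) * s') =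
      (c⁻¹ * c'⁻¹) • (t * wordElt K e * s') - (c⁻¹ * c'⁻¹) • (s * wordElt K e * t') := by
    rw [wordElt_mul, wordElt_mul, e1, e2]
    simp only [mul_sub, sub_mul, mul_smul_comm, smul_mul_assoc, smul_sub, smul_smul, mul_assoc]
    rw [mul_comm c'⁻¹ c⁻¹]
    abel
  rw [key]
  exact sub_mem (Submodule.smul_mem _ _ h2) (Submodule.smul_mem _ _ h1)

/-- The case of `sub_mem_multipleSpan` in which the first leading word starts at the left end of `w`.
The second one then lies behind it, inside it, or overlaps its right end. -/
lemma sub_mem_multipleSpan_of_prefix (hr : IsMonomialOrder r) (hS : CompositionsTrivial r S)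
    {s s' : FreeAlgebra K X} (hs : s ∈ S) (hs' : s' ∈ S) {u u' : FreeMonoid X}
    (hu : IsLeadingWord r s u) (hu' : IsLeadingWord r s' u') {b a' b' : FreeMonoid X}
    (hw : u * b = a' * (u' * b')) :
    (coeff s u)⁻¹ • (s * wordElt K b) -
      (coeff s' u')⁻¹ • (wordElt K a' * s' * wordElt K b') ∈ multipleSpan r S (r · (u * b)) := by
  -- `disj` is the case where the second leading word begins after the end of the first.
  have disj : ∀ e, a' = u * e → b = e * (u' * b') →
      (coeff s u)⁻¹ • (s * wordElt K b) -
        (coeff s' u')⁻¹ • (wordElt K a' * s' * wordElt K b') ∈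
          multipleSpan r S (r · (u * b)) := by
    rintro e rfl rfl
    have h := mul_mul_mem_multipleSpan (Q' := (r · (u * (e * (u' * b'))))) 1 b'
      (fun v hv => by simpa [mul_assoc] using hr.mul_mul _ _ 1 b' hv)
      (disjoint_sub_mem_multipleSpan hr hs hs' hu hu' e)
    simpa [wordElt_mul, wordElt_one, mul_sub, sub_mul, mul_assoc] using h
  rcases mul_eq_mul_cases hw with ⟨e, he, hb⟩ | ⟨e, he, hb⟩
  · exact disj e he hb
  rcases mul_eq_mul_cases hb with ⟨k, rfl, rfl⟩ | ⟨k, hk, rfl⟩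
  · have h := (hS s hs s' hs' u u' hu hu').2 u a' k rfl (by rw [he, mul_assoc])
    have h := mul_mul_mem_multipleSpan (Q' := (r · (u * b))) 1 b
      (fun v hv => by simpa [mul_assoc] using hr.mul_mul _ _ 1 b hv) (isTrivialMod_iff.1 h)
    simpa [wordElt_mul, wordElt_one, mul_sub, sub_mul, mul_assoc] using h
  · -- An empty overlap `e` is not a composition: the two leading words are then disjoint.
    by_cases h1 : e = 1
    · subst h1
      exact disj 1 (by simpa using he.symm) (by simp [hk])
    · have hlen : (u * k).length < u.length + u'.length := by
        have := mt FreeMonoid.length_eq_zero.1 h1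
        simp only [hk, FreeMonoid.length_mul]
        omega
      have h := (hS s hs s' hs' u u' hu hu').1 (u * k) a' k rfl
        (by rw [he, hk, mul_assoc]) hlen
      have h := mul_mul_mem_multipleSpan (Q' := (r · (u * (k * b')))) 1 b'
        (fun v hv => by simpa [mul_assoc] using hr.mul_mul _ _ 1 b' hv) (isTrivialMod_iff.1 h)
      simpa [wordElt_mul, wordElt_one, mul_sub, sub_mul, mul_assoc] using h

/-- If all compositions are trivial, two normalized multiples with the same leading word `w` agree
modulo multiples with leading word smaller than `w`. -/
lemma sub_mem_multipleSpan (hr : IsMonomialOrder r) (hS : CompositionsTrivial r S)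
    {s s' : FreeAlgebra K X} (hs : s ∈ S) (hs' : s' ∈ S) {u u' : FreeMonoid X}
    (hu : IsLeadingWord r s u) (hu' : IsLeadingWord r s' u') {a b a' b' : FreeMonoid X}
    (hw : a * u * b = a' * u' * b') :
    (coeff s u)⁻¹ • (wordElt K a * s * wordElt K b) -
      (coeff s' u')⁻¹ • (wordElt K a' * s' * wordElt K b') ∈
        multipleSpan r S (r · (a * u * b)) := by
  rw [mul_assoc, mul_assoc a'] at hw
  rcases mul_eq_mul_cases hw with ⟨e, rfl, he⟩ | ⟨e, rfl, he⟩
  · have h := mul_mul_mem_multipleSpan (Q' := (r · (a * u * b))) a 1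
      (fun v hv => by simpa [mul_assoc] using hr.mul_mul _ _ a 1 hv)
      (sub_mem_multipleSpan_of_prefix hr hS hs hs' hu hu' he)
    simpa [wordElt_mul, wordElt_one, mul_sub, sub_mul, mul_assoc] using h
  · have h := mul_mul_mem_multipleSpan (Q' := (r · (a' * e * u * b))) a' 1
      (fun v hv => by simpa [mul_assoc, he] using hr.mul_mul _ _ a' 1 hv)
      (sub_mem_multipleSpan_of_prefix hr hS hs' hs hu' hu he)
    rw [← neg_mem_iff, neg_sub]
    simpa [wordElt_mul, wordElt_one, mul_sub, sub_mul, mul_assoc] using h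

/-- If all compositions are trivial, a nonzero combination of multiples can be written with a single
multiple of largest leading word, up to multiples with smaller leading words. -/
lemma eq_zero_or_exists_of_mem_multipleSpan (hr : IsMonomialOrder r)
    (hS : CompositionsTrivial r S) {Q : FreeMonoid X → Prop} {p : FreeAlgebra K X}
    (hp : p ∈ multipleSpan r S Q) :
    p = 0 ∨ ∃ s ∈ S, ∃ u a b : FreeMonoid X, IsLeadingWord r s u ∧ Q (a * u * b) ∧ ∃ c : K,
      p - c • (wordElt K a * s * wordElt K b) ∈ multipleSpan r S (r · (a * u * b)) := by
  have := hr.wellOrder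
  -- An element of smaller leading word is absorbed into the error term of the other one.
  have absorb : ∀ {p p' s s' : FreeAlgebra K X} {u a b u' a' b' : FreeMonoid X} {c c' : K},
      s ∈ S → IsLeadingWord r s u → r (a * u * b) (a' * u' * b') →
      p - c • (wordElt K a * s * wordElt K b) ∈ multipleSpan r S (r · (a * u * b)) →
      p' - c' • (wordElt K a' * s' * wordElt K b') ∈ multipleSpan r S (r · (a' * u' * b')) →
      p + p' - c' • (wordElt K a' * s' * wordElt K b') ∈
        multipleSpan r S (r · (a' * u' * b')) := by
    intro p p' s s' u a b u' a' b' c c' hs hu hlt h h'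
    have h1 : c • (wordElt K a * s * wordElt K b) ∈ multipleSpan r S (r · (a' * u' * b')) :=
      Submodule.smul_mem _ _ (Submodule.subset_span ⟨s, hs, u, a, b, hu, hlt, rfl⟩)
    have h2 := multipleSpan_mono (fun v hv => hr.trans hv hlt) h
    convert add_mem (add_mem h1 h2) h' using 1
    abel
  induction hp using Submodule.span_induction with
  | mem x hx =>
    obtain ⟨s, hs, u, a, b, hu, hQ, rfl⟩ := hx
    exact .inr ⟨s, hs, u, a, b, hu, hQ, 1, by simp⟩
  | zero => exact .inl rfl
  | add x y _ _ hx hy =>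
    rcases hx with rfl | ⟨s, hs, u, a, b, hu, hQ, c, h⟩
    · simpa using hy
    rcases hy with rfl | ⟨s', hs', u', a', b', hu', hQ', c', h'⟩
    · exact .inr ⟨s, hs, u, a, b, hu, hQ, c, by simpa using h⟩
    right
    rcases trichotomous_of r (a * u * b) (a' * u' * b') with hlt | heq | hlt
    · exact ⟨s', hs', u', a', b', hu', hQ', c', absorb hs hu hlt h h'⟩
    · refine ⟨s, hs, u, a, b, hu, hQ, c + c' * coeff s' u' * (coeff s u)⁻¹, ?_⟩
      have h3 := sub_mem_multipleSpan hr hS hs hs' hu hu' heq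
      rw [← heq] at h'
      convert sub_mem (add_mem h h') (Submodule.smul_mem _ (c' * coeff s' u') h3) using 1
      have hne := hu'.1
      rw [smul_sub, smul_smul, smul_smul, mul_assoc c' _ (coeff s' u')⁻¹, mul_inv_cancel₀ hne]
      module
    · refine ⟨s, hs, u, a, b, hu, hQ, c, ?_⟩
      rw [add_comm]
      exact absorb hs' hu' hlt h' h
  | smul d x _ hx =>
    rcases hx with rfl | ⟨s, hs, u, a, b, hu, hQ, c, h⟩
    · simp
    · refine .inr ⟨s, hs, u, a, b, hu, hQ, d * c, ?_⟩
      simpa [smul_sub, smul_smul] using Submodule.smul_mem _ d h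

/-- Well-founded induction on `w`: if `c ≠ 0`, then `w` is the leading word of `p`; if `c = 0`, then
`p` is a combination of multiples with leading words smaller than `w`. -/
lemma exists_leadingWord_of_sub_mem (hr : IsMonomialOrder r) (hS : CompositionsTrivial r S)
    (w : FreeMonoid X) : ∀ p : FreeAlgebra K X, p ≠ 0 → ∀ s ∈ S, ∀ u a b : FreeMonoid X,
      ∀ c : K, IsLeadingWord r s u → a * u * b = w →
      p - c • (wordElt K a * s * wordElt K b) ∈ multipleSpan r S (r · w) →
      ∃ w' : FreeMonoid X, IsLeadingWord r p w' ∧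
        ∃ s ∈ S, ∃ u a b : FreeMonoid X, IsLeadingWord r s u ∧ w' = a * u * b := by
  have := hr.wellOrder
  induction w using (IsWellFounded.wf (r := r)).induction with
  | _ w ih =>
    rintro p hp s hs u a b c hu rfl h
    by_cases hc : c = 0
    · subst hc
      rw [zero_smul, sub_zero] at h
      rcases eq_zero_or_exists_of_mem_multipleSpan hr hS h with
        h0 | ⟨s', hs', u', a', b', hu', hlt, c', h'⟩
      · exact absurd h0 hp
      · exact ih _ hlt p hp s' hs' u' a' b' c' hu' rfl h'
    · refine ⟨_, ?_, s, hs, u, a, b, hu, rfl⟩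
      obtain ⟨t, ht, he⟩ := hu.mul_mul hr a b
      have h1 := add_mem (multipleSpan_le_lowerSpan hr _ h) (Submodule.smul_mem _ c ht)
      have := isLeadingWord_of_mem_lowerSpan hr h1 (mul_ne_zero hc hu.1)
      convert this using 1
      rw [he, smul_add, smul_smul]
      abel

/-- Zero elements of `S` have no leading word, but contribute nothing to the ideal. -/
lemma mem_multipleSpan_of_mem_span (hr : IsMonomialOrder r) {p : FreeAlgebra K X}
    (hp : p ∈ TwoSidedIdeal.span S) : p ∈ multipleSpan r S fun _ => True := by
  rw [TwoSidedIdeal.mem_span_iff_mem_addSubgroup_closure] at hp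
  induction hp using AddSubgroup.closure_induction with
  | mem x hx =>
    obtain ⟨_, ⟨y, -, s, hs, rfl⟩, z, -, rfl⟩ := hx
    by_cases h0 : s = 0
    · simp [h0]
    obtain ⟨u, hu⟩ := exists_isLeadingWord hr h0
    have hy : y ∈ Submodule.span K (Set.range (wordElt K (X := X))) := by
      simp [span_range_wordElt]
    have hz : z ∈ Submodule.span K (Set.range (wordElt K (X := X))) := by
      simp [span_range_wordElt]
    change y * s * z ∈ _
    induction hy using Submodule.span_induction with
    | mem y hy =>
      obtain ⟨a, rfl⟩ := hy
      induction hz using Submodule.span_induction with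
      | mem z hz =>
        obtain ⟨b, rfl⟩ := hz
        exact Submodule.subset_span ⟨s, hs, u, a, b, hu, trivial, rfl⟩
      | zero => simp
      | add x y _ _ hx hy => simpa [mul_add] using add_mem hx hy
      | smul c x _ hx => simpa using Submodule.smul_mem _ c hx
    | zero => simp
    | add x y _ _ hx hy => simpa [add_mul] using add_mem hx hy
    | smul c x _ hx => simpa using Submodule.smul_mem _ c hx
  | zero => exact zero_mem _
  | add x y _ _ hx hy => exact add_mem hx hy
  | neg x _ hx => exact neg_mem hx

/-- The composition-diamond lemma: a set all of whose compositions are trivial is a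
Gröbner–Shirshov basis of the ideal it generates. -/
theorem CompositionsTrivial.isGroebnerShirshovBasis (hr : IsMonomialOrder r)
    (hS : CompositionsTrivial r S) : IsGroebnerShirshovBasis r S (TwoSidedIdeal.span S) where
  span_eq := rfl
  leading p hp hp0 := by
    rcases eq_zero_or_exists_of_mem_multipleSpan hr hS (mem_multipleSpan_of_mem_span hr hp) with
      h0 | ⟨s, hs, u, a, b, hu, -, c, h⟩
    · exact absurd h0 hp0
    · exact exists_leadingWord_of_sub_mem hr hS _ p hp0 s hs u a b c hu rfl h

end Diamond

/-! ### The deg-lex ordering -/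

section DegLex

variable {n : ℕ}

lemma letterLT_iff {x y : Fin n × Fin n} : letterLT x y ↔ toLex x < toLex y := by
  simp [letterLT, Prod.Lex.toLex_lt_toLex]

instance isWellOrder_letterLT : IsWellOrder (Fin n × Fin n) letterLT := by
  have h : (letterLT : Fin n × Fin n → Fin n × Fin n → Prop) = toLex ⁻¹'o (· < ·) := by
    ext x y
    exact letterLT_iff
  rw [h]
  exact (RelIso.preimage toLex (· < ·)).toRelEmbedding.isWellOrder

/-- The lexicographic order alone is not compatible with multiplication on the right (a proper
prefix is smaller), but deg-lex compares only words of equal length lexicographically. -/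
lemma degLex_mul_right {u v : FreeMonoid (Fin n × Fin n)} (huv : degLex u v)
    (z : FreeMonoid (Fin n × Fin n)) : degLex (u * z) (v * z) := by
  rw [degLex, List.shortlex_def] at *
  simp only [FreeMonoid.toList_mul, List.length_append]
  rcases huv with h | ⟨hl, h⟩
  · left; omega
  · right
    refine ⟨by omega, ?_⟩
    generalize u.toList = l at *
    generalize v.toList = l' at *
    induction h with
    | nil => simp at hl
    | cons _ ih => exact .cons (ih (by simpa using hl))
    | rel h => exact .rel h

lemma isMonomialOrder_degLex : IsMonomialOrder (degLex (n := n)) where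
  wellOrder :=
    { wf := InvImage.wf _ (List.Shortlex.wf isWellOrder_letterLT.wf)
      trichotomous := (InvImage.trichotomous
        (r := List.Shortlex letterLT) FreeMonoid.toList.injective).trichotomous }
  mul_mul u v w z huv := by
    rw [mul_assoc, mul_assoc]
    exact List.Shortlex.append_left (degLex_mul_right huv z) w.toList

lemma degLex_pair {a b x y : Fin n × Fin n} (hlt : letterLT a x ∨ a = x ∧ letterLT b y) :
    degLex (FreeMonoid.of a * FreeMonoid.of b) (FreeMonoid.of x * FreeMonoid.of y) := by
  refine List.Shortlex.of_lex rfl ?_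
  change List.Lex letterLT [a, b] [x, y]
  rcases hlt with h | ⟨rfl, h⟩
  · exact .rel h
  · exact .cons (.rel h)

lemma degLex_triple {a b c x y z : Fin n × Fin n}
    (hlt : letterLT a x ∨ a = x ∧ (letterLT b y ∨ b = y ∧ letterLT c z)) :
    degLex (FreeMonoid.of a * FreeMonoid.of b * FreeMonoid.of c)
      (FreeMonoid.of x * FreeMonoid.of y * FreeMonoid.of z) := by
  refine List.Shortlex.of_lex rfl ?_
  change List.Lex letterLT [a, b, c] [x, y, z]
  rcases hlt with h | ⟨rfl, h | ⟨rfl, h⟩⟩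
  · exact .rel h
  · exact .cons (.rel h)
  · exact .cons (.cons (.rel h))

end DegLex

/-! ### The relations as rewriting rules -/

section Rewriting

variable {K : Type*} [Field K] {n : ℕ}

/-- The coefficient of `D_{st} D_{ij}` when the decreasing product `D_{ij} D_{st}` is rewritten. -/
def swapCoeff (q : K) (x y : Fin n × Fin n) : K :=
  if x.1 = y.1 then 1 else if x.2 ≤ y.2 then q else 1

/-- The coefficient of `D_{sj} D_{it}` when the decreasing product `D_{ij} D_{st}` is rewritten. -/
def crossCoeff (q : K) (x y : Fin n × Fin n) : K :=
  if x.1 = y.1 then 0 else if x.2 ≤ y.2 then 0 else q - 1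

/-- The monic relation with leading word `x y`, for letters `y < x`: all the families of defining
relations in one formula. -/
noncomputable def monicRel (q : K) (x y : Fin n × Fin n) : FreeAlgebra K (Fin n × Fin n) :=
  FreeAlgebra.ι K x * FreeAlgebra.ι K y -
    (swapCoeff q x y • (FreeAlgebra.ι K y * FreeAlgebra.ι K x) +
      crossCoeff q x y • (FreeAlgebra.ι K (y.1, x.2) * FreeAlgebra.ι K (x.1, y.2)))

lemma f_eq_monicRel (q : K) {i j s t : Fin n} (his : s < i) (hjt : j ≤ t) :
    f K q i j s t = monicRel q (i, j) (s, t) := by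
  simp [f, monicRel, swapCoeff, crossCoeff, his.ne', hjt, D]

lemma g_eq_monicRel (q : K) {i j s t : Fin n} (his : s < i) (htj : t < j) :
    g K q i j s t = monicRel q (i, j) (s, t) := by
  simp [g, monicRel, swapCoeff, crossCoeff, his.ne', htj.not_ge, D, sub_sub]

lemma h_eq_monicRel (q : K) (i j k : Fin n) : h K i j k = monicRel q (i, j) (i, k) := by
  simp [h, monicRel, swapCoeff, crossCoeff, D]

lemma monicRel_mem_relations (q : K) {x y : Fin n × Fin n} (hyx : letterLT y x) :
    monicRel q x y ∈ relations K n q := by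
  obtain ⟨i, j⟩ := x
  obtain ⟨s, t⟩ := y
  rcases hyx with his | ⟨his, htj⟩
  · rcases le_or_gt j t with hjt | htj
    · exact .inl (.inl ⟨i, j, s, t, his, hjt, (f_eq_monicRel q his hjt).symm⟩)
    · exact .inl (.inr ⟨i, j, s, t, his, htj, (g_eq_monicRel q his htj).symm⟩)
  · obtain rfl : s = i := his
    exact .inr ⟨s, j, t, (h_eq_monicRel q s j t).symm⟩

lemma eq_zero_or_exists_smul_monicRel {q : K} {p : FreeAlgebra K (Fin n × Fin n)}
    (hp : p ∈ relations K n q) :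
    p = 0 ∨ ∃ x y, letterLT y x ∧ ∃ c : K, c ≠ 0 ∧ p = c • monicRel q x y := by
  rcases hp with (⟨i, j, s, t, his, hjt, rfl⟩ | ⟨i, j, s, t, his, hjt, rfl⟩) | ⟨i, j, k, rfl⟩
  · exact .inr ⟨_, _, .inl his, 1, one_ne_zero, by rw [one_smul, f_eq_monicRel q his hjt]⟩
  · exact .inr ⟨_, _, .inl his, 1, one_ne_zero, by rw [one_smul, g_eq_monicRel q his hjt]⟩
  · rcases lt_trichotomy j k with hjk | rfl | hjk
    · refine .inr ⟨(i, k), (i, j), .inr ⟨rfl, hjk⟩, -1, by simp, ?_⟩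
      rw [← h_eq_monicRel]
      simp [h]
    · exact .inl (by simp [h])
    · refine .inr ⟨(i, j), (i, k), .inr ⟨rfl, hjk⟩, 1, one_ne_zero, ?_⟩
      rw [one_smul, h_eq_monicRel q i j k]

lemma monicRel_tail_mem_lowerSpan (q : K) {x y : Fin n × Fin n} (hyx : letterLT y x) :
    -(swapCoeff q x y • (FreeAlgebra.ι K y * FreeAlgebra.ι K x) +
      crossCoeff q x y • (FreeAlgebra.ι K (y.1, x.2) * FreeAlgebra.ι K (x.1, y.2))) ∈
      lowerSpan K degLex (FreeMonoid.of x * FreeMonoid.of y) := by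
  simp only [← wordElt_of, ← wordElt_mul]
  refine neg_mem (add_mem (Submodule.smul_mem _ _ (wordElt_mem_lowerSpan ?_)) ?_)
  · exact degLex_pair (.inl hyx)
  · by_cases hrow : x.1 = y.1
    · simp [crossCoeff, hrow]
    · refine Submodule.smul_mem _ _ (wordElt_mem_lowerSpan (degLex_pair (.inl (.inl ?_))))
      exact hyx.resolve_right fun h => hrow h.1.symm

lemma monicRel_eq (q : K) (x y : Fin n × Fin n) :
    monicRel q x y = (1 : K) • wordElt K (FreeMonoid.of x * FreeMonoid.of y) +
      -(swapCoeff q x y • (FreeAlgebra.ι K y * FreeAlgebra.ι K x) +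
        crossCoeff q x y • (FreeAlgebra.ι K (y.1, x.2) * FreeAlgebra.ι K (x.1, y.2))) := by
  rw [monicRel, wordElt_mul, wordElt_of, wordElt_of, one_smul, sub_eq_add_neg]

lemma isLeadingWord_monicRel (q : K) {x y : Fin n × Fin n} (hyx : letterLT y x) :
    IsLeadingWord degLex (monicRel q x y) (FreeMonoid.of x * FreeMonoid.of y) := by
  rw [monicRel_eq]
  exact isLeadingWord_of_mem_lowerSpan isMonomialOrder_degLex
    (monicRel_tail_mem_lowerSpan q hyx) one_ne_zero

/-- Up to normalization, the nonzero relations are exactly the `monicRel q x y` with `y < x`. -/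
lemma exists_smul_eq_monicRel {q : K} {p : FreeAlgebra K (Fin n × Fin n)}
    (hp : p ∈ relations K n q) {u : FreeMonoid (Fin n × Fin n)} (hu : IsLeadingWord degLex p u) :
    ∃ x y, letterLT y x ∧ u = FreeMonoid.of x * FreeMonoid.of y ∧
      (coeff p u)⁻¹ • p = monicRel q x y := by
  rcases eq_zero_or_exists_smul_monicRel hp with rfl | ⟨x, y, hyx, c, hc, rfl⟩
  · exact absurd hu.1 (by simp [coeff])
  have ht := Submodule.smul_mem _ c (monicRel_tail_mem_lowerSpan q hyx)
  have he : c • monicRel q x y = _ := (congrArg (c • ·) (monicRel_eq q x y)).trans (smul_add _ _ _)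
  rw [one_smul] at he
  have hl := isLeadingWord_of_mem_lowerSpan isMonomialOrder_degLex ht hc
  have hcoeff := coeff_eq_of_mem_lowerSpan isMonomialOrder_degLex ht c
  rw [← he] at hl hcoeff
  obtain rfl := hu.unique isMonomialOrder_degLex hl
  refine ⟨x, y, hyx, rfl, ?_⟩
  rw [hcoeff, inv_smul_smul₀ hc]

end Rewriting

/-! ### Confluence on words of three letters -/

section Confluence

variable {K : Type*} [Field K] {n : ℕ} {V : Type*} [AddCommGroup V] [Module K V]

lemma le_cases {α : Type*} [LinearOrder α] (a b : α) :
    (a ≤ b ∧ ¬ b ≤ a) ∨ a = b ∨ (b ≤ a ∧ ¬ a ≤ b) := by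
  rcases lt_trichotomy a b with hab | hab | hab
  · exact .inl ⟨hab.le, hab.not_ge⟩
  · exact .inr (.inl hab)
  · exact .inr (.inr ⟨hab.le, hab.not_ge⟩)

lemma comm_of_lt_comm {α : Type*} [LinearOrder α] (P : α → α → Prop)
    (hsymm : ∀ a b, P a b → P b a) (hrefl : ∀ a, P a a) (hlt : ∀ a b, b < a → P a b) (a b : α) :
    P a b := by
  rcases lt_trichotomy a b with hab | rfl | hab
  · exact hsymm _ _ (hlt _ _ hab)
  · exact hrefl _
  · exact hlt _ _ hab

/-- The two ways of rewriting `x y z`, for letters `z < y < x`, agree in every module in which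
products of three letters smaller than `x y z` obey the rewriting rules. -/
lemma rewriting_confluent (q : K) (m : Fin n × Fin n → Fin n × Fin n → Fin n × Fin n → V)
    {x y z : Fin n × Fin n} (hyx : letterLT y x) (hzy : letterLT z y)
    (hleft : ∀ a b c, letterLT b a →
      (letterLT a x ∨ a = x ∧ (letterLT b y ∨ b = y ∧ letterLT c z)) →
      m a b c = swapCoeff q a b • m b a c + crossCoeff q a b • m (b.1, a.2) (a.1, b.2) c)
    (hright : ∀ a b c, letterLT c b →
      (letterLT a x ∨ a = x ∧ (letterLT b y ∨ b = y ∧ letterLT c z)) →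
      m a b c = swapCoeff q b c • m a c b + crossCoeff q b c • m a (c.1, b.2) (b.1, c.2)) :
    swapCoeff q x y • m y x z + crossCoeff q x y • m (y.1, x.2) (x.1, y.2) z =
      swapCoeff q y z • m x z y + crossCoeff q y z • m x (z.1, y.2) (y.1, z.2) := by
  obtain ⟨i, j⟩ := x
  obtain ⟨s, t⟩ := y
  obtain ⟨p, k⟩ := z
  simp only [letterLT] at *
  rcases hyx with his | ⟨his, htj⟩ <;> rcases hzy with hps | ⟨hps, hkt⟩
  · -- Rows `p < s < i`: swapping the rows at positions 12, 23, 12 or at positions 23, 12, 23 gives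
    -- the same combination of column words, a braid relation that is checked on the 13 weak
    -- orders of the columns.
    have hpi := hps.trans his
    have l1 : ∀ a b c, m (s, a) (i, b) (p, c) =
        swapCoeff q (i, b) (p, c) • m (s, a) (p, c) (i, b) +
          crossCoeff q (i, b) (p, c) • m (s, a) (p, b) (i, c) := fun a b c =>
      hright _ _ _ (.inl hpi) (.inl (.inl his))
    have l2 : ∀ a b c, m (s, a) (p, b) (i, c) =
        swapCoeff q (s, a) (p, b) • m (p, b) (s, a) (i, c) +
          crossCoeff q (s, a) (p, b) • m (p, a) (s, b) (i, c) := fun a b c =>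
      hleft _ _ _ (.inl hps) (.inl (.inl his))
    -- Here the first letter is unchanged, so the word is smaller because of its second letter.
    have l3 : ∀ b c, m (i, j) (p, b) (s, c) =
        swapCoeff q (i, j) (p, b) • m (p, b) (i, j) (s, c) +
          crossCoeff q (i, j) (p, b) • m (p, j) (i, b) (s, c) := fun b c =>
      hleft _ _ _ (.inl hpi) (.inr ⟨rfl, .inl (.inl hps)⟩)
    have l4 : ∀ a b c, m (p, a) (i, b) (s, c) =
        swapCoeff q (i, b) (s, c) • m (p, a) (s, c) (i, b) +
          crossCoeff q (i, b) (s, c) • m (p, a) (s, b) (i, c) := fun a b c =>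
      hright _ _ _ (.inl his) (.inl (.inl hpi))
    simp only [l1, l2, l3, l4]
    clear l1 l2 l3 l4 hleft hright
    have his' := his.ne'
    have hps' := hps.ne'
    have hpi' := hpi.ne'
    rcases le_cases j t with ⟨h1, h1'⟩ | h1 | ⟨h1, h1'⟩ <;>
      rcases le_cases t k with ⟨h2, h2'⟩ | h2 | ⟨h2, h2'⟩ <;>
      rcases le_cases j k with ⟨h3, h3'⟩ | h3 | ⟨h3, h3'⟩ <;> first | omega | skip
    all_goals
      subst_vars
      simp only [swapCoeff, crossCoeff, *, le_refl, if_true, if_false] <;> module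
  · -- Rows `p = s < i`, so `k < t`.
    obtain rfl : p = s := hps
    have l1 : ∀ a b c, m (p, a) (i, b) (p, c) =
        swapCoeff q (i, b) (p, c) • m (p, a) (p, c) (i, b) +
          crossCoeff q (i, b) (p, c) • m (p, a) (p, b) (i, c) := fun a b c =>
      hright _ _ _ (.inl his) (.inl (.inl his))
    have l2 : m (i, j) (p, k) (p, t) =
        swapCoeff q (i, j) (p, k) • m (p, k) (i, j) (p, t) +
          crossCoeff q (i, j) (p, k) • m (p, j) (i, k) (p, t) :=
      hleft _ _ _ (.inl his) (.inr ⟨rfl, .inl (.inr ⟨rfl, hkt⟩)⟩)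
    have l3 := comm_of_lt_comm (fun a b => ∀ c, m (p, a) (p, b) (i, c) = m (p, b) (p, a) (i, c))
      (fun _ _ h c => (h c).symm) (fun _ _ => rfl) fun a b hba c => by
        simpa [swapCoeff, crossCoeff] using
          hleft (p, a) (p, b) (i, c) (.inr ⟨rfl, hba⟩) (.inl (.inl his))
    -- Sort the columns within the row `p`, so that equal words become syntactically equal.
    simp only [l1, l2, l3 t k j, l3 j k t, l3 j t k]
    clear l1 l2 l3 hleft hright
    have his' := his.ne'
    have hkt1 := hkt.le
    have hkt2 := hkt.not_ge
    rcases le_cases j t with ⟨h1, h1'⟩ | h1 | ⟨h1, h1'⟩ <;>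
      rcases le_cases j k with ⟨h3, h3'⟩ | h3 | ⟨h3, h3'⟩ <;> first | omega | skip
    all_goals
      subst_vars
      simp only [swapCoeff, crossCoeff, *, le_refl, if_true, if_false]
      module
  · -- Rows `p < s = i`, so `t < j`.
    obtain rfl : s = i := his
    have l1 : ∀ b c, m (s, t) (s, b) (p, c) =
        swapCoeff q (s, b) (p, c) • m (s, t) (p, c) (s, b) +
          crossCoeff q (s, b) (p, c) • m (s, t) (p, b) (s, c) := fun b c =>
      hright _ _ _ (.inl hps) (.inl (.inr ⟨rfl, htj⟩))
    -- The words on the left-hand side are below `x y z` only because `a ≤ j`.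
    have l2 : ∀ a b c, a ≤ j → m (s, a) (p, b) (s, c) =
        swapCoeff q (s, a) (p, b) • m (p, b) (s, a) (s, c) +
          crossCoeff q (s, a) (p, b) • m (p, a) (s, b) (s, c) := fun a b c ha =>
      hleft _ _ _ (.inl hps) (ha.lt_or_eq.imp (fun h => .inr ⟨rfl, h⟩)
        fun h => ⟨by rw [h], .inl (.inl hps)⟩)
    have l3 := comm_of_lt_comm (fun a b => ∀ c, m (p, c) (s, a) (s, b) = m (p, c) (s, b) (s, a))
      (fun _ _ h c => (h c).symm) (fun _ _ => rfl) fun a b hba c => by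
        simpa [swapCoeff, crossCoeff] using
          hright (p, c) (s, a) (s, b) (.inr ⟨rfl, hba⟩) (.inl (.inl hps))
    -- Sort the columns within the row `s`.
    simp only [l1, l2 j _ _ le_rfl, l2 t _ _ htj.le, l3 j t k, l3 t k j, l3 j k t]
    clear l1 l2 l3 hleft hright
    have hps' := hps.ne'
    have htj1 := htj.le
    have htj2 := htj.not_ge
    rcases le_cases t k with ⟨h2, h2'⟩ | h2 | ⟨h2, h2'⟩ <;>
      rcases le_cases j k with ⟨h3, h3'⟩ | h3 | ⟨h3, h3'⟩ <;> first | omega | skip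
    all_goals
      subst_vars
      simp only [swapCoeff, crossCoeff, *, le_refl, if_true, if_false]
      module
  · -- A single row, so `k < t < j` and all the letters commute.
    obtain rfl : s = i := his
    obtain rfl : p = s := hps
    have hkj := hkt.trans htj
    have e1 := hright (p, t) (p, j) (p, k) (.inr ⟨rfl, hkj⟩) (.inl (.inr ⟨rfl, htj⟩))
    have e2 := hleft (p, t) (p, k) (p, j) (.inr ⟨rfl, hkt⟩) (.inl (.inr ⟨rfl, htj⟩))
    have e3 := hleft (p, j) (p, k) (p, t) (.inr ⟨rfl, hkj⟩)
      (.inr ⟨rfl, .inl (.inr ⟨rfl, hkt⟩)⟩)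
    have e4 := hright (p, k) (p, j) (p, t) (.inr ⟨rfl, htj⟩) (.inl (.inr ⟨rfl, hkj⟩))
    simp only [swapCoeff, crossCoeff, if_true, one_smul, zero_smul, add_zero] at e1 e2 e3 e4 ⊢
    rw [e1, e2, e3, e4]

end Confluence

/-! ### Triviality of the compositions -/

section Compositions

variable {K : Type*} [Field K] {n : ℕ}

/-- The composition with overlap `x y z`. The rewriting rules hold in the quotient of the free
algebra by the elements that are trivial modulo `x y z`, so `rewriting_confluent` applies there. -/
lemma overlap_mem_multipleSpan (q : K) {x y z : Fin n × Fin n} (hyx : letterLT y x)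
    (hzy : letterLT z y) :
    monicRel q x y * FreeAlgebra.ι K z - FreeAlgebra.ι K x * monicRel q y z ∈
      multipleSpan degLex (relations K n q)
        (degLex · (FreeMonoid.of x * FreeMonoid.of y * FreeMonoid.of z)) := by
  set M := multipleSpan degLex (relations K n q)
    (degLex · (FreeMonoid.of x * FreeMonoid.of y * FreeMonoid.of z))
  have key := rewriting_confluent q
    (fun a b c => M.mkQ (FreeAlgebra.ι K a * FreeAlgebra.ι K b * FreeAlgebra.ι K c)) hyx hzy
    (fun a b c hba hlt => by
      have h : monicRel q a b * FreeAlgebra.ι K c ∈ M :=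
        Submodule.subset_span ⟨_, monicRel_mem_relations q hba, _, 1, FreeMonoid.of c,
          isLeadingWord_monicRel q hba, by simpa using degLex_triple hlt,
          by simp [wordElt_one, wordElt_of]⟩
      rw [← map_smul, ← map_smul, ← map_add, ← sub_eq_zero, ← map_sub, Submodule.mkQ_apply,
        Submodule.Quotient.mk_eq_zero]
      simpa [monicRel, sub_mul, add_mul] using h)
    (fun a b c hcb hlt => by
      have h : FreeAlgebra.ι K a * monicRel q b c ∈ M :=
        Submodule.subset_span ⟨_, monicRel_mem_relations q hcb, _, FreeMonoid.of a, 1,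
          isLeadingWord_monicRel q hcb, by simpa [mul_assoc] using degLex_triple hlt,
          by simp [wordElt_one, wordElt_of]⟩
      rw [← map_smul, ← map_smul, ← map_add, ← sub_eq_zero, ← map_sub, Submodule.mkQ_apply,
        Submodule.Quotient.mk_eq_zero]
      simpa [monicRel, mul_sub, mul_add, mul_assoc] using h)
  rw [← map_smul, ← map_smul, ← map_add, ← map_smul, ← map_smul, ← map_add, eq_comm,
    ← sub_eq_zero, ← map_sub, Submodule.mkQ_apply, Submodule.Quotient.mk_eq_zero] at key
  convert key using 1
  simp only [monicRel, sub_mul, add_mul, mul_sub, mul_add, mul_assoc, smul_mul_assoc,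
    mul_smul_comm]
  abel

lemma compositionsTrivial_relations (q : K) :
    CompositionsTrivial degLex (relations K n q) := by
  intro p hp p' hp' u v hu hv
  obtain ⟨x, y, hyx, rfl, he⟩ := exists_smul_eq_monicRel hp hu
  obtain ⟨x', y', hyx', rfl, he'⟩ := exists_smul_eq_monicRel hp' hv
  refine ⟨fun w a b hb ha hlen => ?_, fun w a b hw hab => ?_⟩
  · rw [isTrivialMod_iff, ← smul_mul_assoc, ← mul_smul_comm, he, he']
    have hla := congrArg FreeMonoid.length ha
    have hlb := congrArg FreeMonoid.length hb
    simp only [FreeMonoid.length_mul, FreeMonoid.length_of] at hla hlb hlen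
    -- All leading words have length 2: either they coincide, or they share one letter.
    obtain h0 | h1 : b.length = 0 ∨ b.length = 1 := by omega
    · obtain rfl := FreeMonoid.length_eq_zero.1 h0
      obtain rfl := FreeMonoid.length_eq_zero.1 (show a.length = 0 by omega)
      have h : [x, y] = [x', y'] := hb.symm.trans ha
      obtain ⟨rfl, rfl⟩ : x = x' ∧ y = y' := by simpa using h
      simp [wordElt_one]
    · obtain ⟨z, rfl⟩ := FreeMonoid.length_eq_one.1 h1
      obtain ⟨x₀, rfl⟩ := FreeMonoid.length_eq_one.1 (show a.length = 1 by omega)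
      have h : [x, y, z] = [x₀, x', y'] := hb.symm.trans ha
      obtain ⟨rfl, rfl, rfl⟩ : x = x₀ ∧ y = x' ∧ z = y' := by simpa using h
      rw [hb, wordElt_of, wordElt_of]
      exact overlap_mem_multipleSpan q hyx hyx'
  · rw [isTrivialMod_iff, ← smul_mul_assoc, ← mul_smul_comm, he, he']
    have hl := congrArg FreeMonoid.length (hw.symm.trans hab)
    simp only [FreeMonoid.length_mul, FreeMonoid.length_of] at hl
    obtain rfl := FreeMonoid.length_eq_zero.1 (show a.length = 0 by omega)
    obtain rfl := FreeMonoid.length_eq_zero.1 (show b.length = 0 by omega)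
    have h : [x, y] = [x', y'] := hw.symm.trans hab
    obtain ⟨rfl, rfl⟩ : x = x' ∧ y = y' := by simpa using h
    simp [wordElt_one]

end Compositions

end DipperDonkin

/-- The deg-lex ordering is a monomial ordering, the defining relations are a Gröbner–Shirshov
basis of the ideal that they generate, and all their compositions are trivial. -/
theorem theorem2p1 {K : Type*} [Field K] [CharZero K] (n : ℕ) (hn : 2 ≤ n) (q : K) (hq : q ≠ 0) :
    DipperDonkin.IsMonomialOrder (DipperDonkin.degLex (n := n)) ∧
    DipperDonkin.IsGroebnerShirshovBasis DipperDonkin.degLex (DipperDonkin.relations K n q)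
      (TwoSidedIdeal.span (DipperDonkin.relations K n q)) ∧
    DipperDonkin.CompositionsTrivial DipperDonkin.degLex (DipperDonkin.relations K n q) :=
  ⟨DipperDonkin.isMonomialOrder_degLex,
    (DipperDonkin.compositionsTrivial_relations q).isGroebnerShirshovBasis
      DipperDonkin.isMonomialOrder_degLex,
    DipperDonkin.compositionsTrivial_relations q⟩
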